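/- Let $\mathbb T^d=\mathbb R^d/\mathbb Z^d$, $d\ge 1$, carry the normalized Lebesgue measure. For $f\in L^1(\mathbb T^d)$ (complex valued) put $\hat f(k)=\int_{\mathbb T^d}f(x)e^{-2\pi i k\cdot x}\,dx$ for $k\in\mathbb Z^d$, and for a multi-index $n=(n_1,\dots,n_d)\in\mathbb N_0^d$ let $$\mathcal T_nf(x)=\sum_{|k_1|\le n_1}\cdots\sum_{|k_d|\le n_d}\hat f(k)e^{2\pi i k\cdot x},\qquad \underline n=\min\{n_1,\dots,n_d\}.$$ Let $W^{1,q}(\mathbb T^d)$ be the class of $f\in L^1(\mathbb T^d)$ for which there is $g\in L^q(\mathbb T^d)$ with $\hat g(k)=(1+4\pi^2|k|^2)^{1/2}\hat f(k)$ for all $k\in\mathbb Z^d$. Let $\|\nabla f\|_q$ be the $L^q$ norm of the Euclidean length of the distributional gradient of $f$. For every $q\in(1,\infty)$ there is $\alpha=\alpha(q)\in(0,1]$ such that for every $d\ge1$ there is a constant $C_{q,d}\in(0,\infty)$ with $$\|(\mathcal T_n-\mathcal T_m)f\|_q\le\frac{C_{q,d}}{\underline m^{\alpha}\wedge\underline n^{\alpha}}\,\|\nabla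 f\|_q$$ for all $f\in W^{1,q}(\mathbb T^d)$ with $\int_{\mathbb T^d}f\,dx=0$ and all multi-indices $n,m\in\mathbb N_0^d$. (Where $\underline m\wedge\underline n=0$, the fraction is read as $+\infty$, with $\infty\cdot 0=0$.) -/

import Mathlib

open MeasureTheory
open scoped ENNReal NNReal ContDiff

noncomputable section

namespace TorusSobolev

/-- The torus `𝕋^d = ℝ^d / ℤ^d`. -/
abbrev Torus (d : ℕ) : Type := UnitAddTorus (Fin d)

/-- Lebesgue measure `dx` on the torus: the product of the normalized Haar measures of the circles
`ℝ / ℤ`. This is the measure in Mathlib's Fourier coefficients `UnitAddTorus.mFourierCoeff`. -/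
abbrev torusMeasure (d : ℕ) : Measure (Torus d) :=
  Measure.pi fun _ => AddCircle.haarAddCircle

/-- The rectangular partial sum
`(T_n f)(x) = ∑_{|k_1| ≤ n_1} ⋯ ∑_{|k_d| ≤ n_d} f̂(k) e^{2π i k·x}`, where
`f̂(k) = ∫ f(x) e^{-2π i k·x} dx`. -/
def partialSum {d : ℕ} (n : Fin d → ℕ) (f : Torus d → ℂ) : Torus d → ℂ := fun x =>
  ∑ k ∈ Fintype.piFinset (fun i => Finset.Icc (-(n i : ℤ)) (n i : ℤ)),
    UnitAddTorus.mFourierCoeff f k * UnitAddTorus.mFourier k x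

/-- `min {n_1, …, n_d}` (only used for `d ≥ 1`). -/
def minIndex {d : ℕ} (n : Fin d → ℕ) : ℕ := ⨅ i, n i

/-- `f ∈ W^{s,p}(𝕋^d)` for an integrable function `f`: the distribution `J^s f`, whose Fourier
coefficients are `(1 + 4π²|k|²)^{s/2} f̂(k)`, is a function in `L^p`. (If `s ≥ 0` and `p ≥ 1`, every
distribution with `J^s f ∈ L^p` is an integrable function.) -/
def MemSobolev {d : ℕ} (s : ℝ) (p : ℝ≥0∞) (f : Torus d → ℂ) : Prop :=
  Integrable f (torusMeasure d) ∧
  ∃ g : Torus d → ℂ, Integrable g (torusMeasure d) ∧ MemLp g p (torusMeasure d) ∧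
    ∀ k : Fin d → ℤ, UnitAddTorus.mFourierCoeff g k =
      (((1 + 4 * Real.pi ^ 2 * ∑ i, (k i : ℝ) ^ 2) ^ (s / 2) : ℝ) : ℂ) * UnitAddTorus.mFourierCoeff f k

/-- `φ ∈ C^∞(𝕋^d)`: the lift of `φ` to a `ℤ^d`-periodic function on `ℝ^d` is smooth. -/
def IsTestFunction {d : ℕ} (φ : Torus d → ℂ) : Prop :=
  ContDiff ℝ ∞ (fun x : Fin d → ℝ => φ (fun i => (x i : UnitAddCircle)))

/-- The classical partial derivative `∂φ/∂x_j` on the torus. -/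
def partialDeriv {d : ℕ} (j : Fin d) (φ : Torus d → ℂ) (x : Torus d) : ℂ :=
  deriv (fun t : ℝ => φ (x + Pi.single j (t : UnitAddCircle))) 0

/-- The integrable field `G` is the distributional gradient of the integrable function `f`. -/
def IsWeakGradient {d : ℕ} (f : Torus d → ℂ) (G : Torus d → EuclideanSpace ℂ (Fin d)) : Prop :=
  Integrable f (torusMeasure d) ∧ Integrable G (torusMeasure d) ∧
  ∀ (j : Fin d) (φ : Torus d → ℂ), IsTestFunction φ →
    ∫ x, f x * partialDeriv j φ x ∂torusMeasure d = - ∫ x, G x j * φ x ∂torusMeasure d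

/-- `‖∇f‖_p`, the `L^p` norm of the Euclidean length of the distributional gradient of `f`, with
the usual value `∞` if the gradient is not a function in `L^p`. The weak gradient is unique almost
everywhere, so the infimum runs over at most one value. -/
def gradNorm {d : ℕ} (p : ℝ≥0∞) (f : Torus d → ℂ) : ℝ≥0∞ :=
  ⨅ (G : Torus d → EuclideanSpace ℂ (Fin d)) (_ : IsWeakGradient f G), eLpNorm G p (torusMeasure d)

end TorusSobolev

end

/-!
The partial sums act in each coordinate separately, and `f - T_n f` has the Fourier coefficients
`(1 - ∏ i, 1_{|k_i| ≤ n_i}) f̂(k)`. Order the coordinates so that `n_i` increases and telescope the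
product: every term has a factor `1_{|k_a| > n_a}` in one coordinate `a`, and truncations only in
coordinates `i` with `n_i ≤ n_a`.

Since `∂_a f` has the coefficients `2π i k_a f̂(k)`, the factor `1_{|k_a| > n_a}` amounts to
convolving `∂_a f` in the coordinate `a` with a kernel whose coefficients are `1 / (2π i l)` for
`|l| > n_a`. Its `L¹` norm is at most its `L²` norm, hence `O(n_a^{-1/4})` by Parseval
(`exists_sawtoothTail`; the exponent is not optimal). A truncation is convolution with a Dirichlet
kernel, whose `L¹` norm is `O(n_i^ε)` for each `ε > 0` (`exists_eLpNorm_dirichletKernel_le`). With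
`ε = 1 / (8d)` the truncations together cost at most `n_a^{1/8}`, because `n_i ≤ n_a`, so that
Young's inequality (`eLpNorm_partialConv_le`) leaves `n_a^{-1/8}` (`exists_rectangular_remainder`).
The uniform `L^q` boundedness of partial sums is not needed, and `α = 1/8` serves for every `q`.

It remains to identify functions by their Fourier coefficients (`ae_eq_of_mFourierCoeff_eq`) and to
treat `min n = 0` or `min m = 0` with vanishing gradient norm, where mean zero makes all
coefficients of `f` vanish.
-/

noncomputable section

namespace TorusSobolev

variable {d : ℕ}

/-! ### Fourier coefficients of integrable functions -/

lemma mFourierCoeff_eq_integral_torusMeasure (f : Torus d → ℂ) (k : Fin d → ℤ) :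
    UnitAddTorus.mFourierCoeff f k =
      ∫ x, UnitAddTorus.mFourier (-k) x * f x ∂torusMeasure d := rfl

lemma norm_mFourier_apply (k : Fin d → ℤ) (x : Torus d) : ‖UnitAddTorus.mFourier k x‖ = 1 := by
  simp only [UnitAddTorus.mFourier, ContinuousMap.coe_mk, norm_prod, fourier_apply,
    Circle.norm_coe, Finset.prod_const_one]

lemma integrable_mFourier_mul {f : Torus d → ℂ} (hf : Integrable f (torusMeasure d))
    (k : Fin d → ℤ) :
    Integrable (fun x => UnitAddTorus.mFourier k x * f x) (torusMeasure d) :=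
  hf.bdd_mul (c := 1) (UnitAddTorus.mFourier k).continuous.aestronglyMeasurable
    (ae_of_all _ fun x => (norm_mFourier_apply k x).le)

lemma integrable_continuousMap_mul {X : Type*} [TopologicalSpace X] [CompactSpace X]
    [MeasurableSpace X] [BorelSpace X] {μ : Measure X} {f : X → ℂ}
    (hf : Integrable f μ) (φ : C(X, ℂ)) :
    Integrable (fun x => φ x * f x) μ :=
  hf.bdd_mul (c := ‖φ‖) φ.continuous.aestronglyMeasurable (ae_of_all _ φ.norm_coe_le_norm)

/-- Indicators of closed sets are bounded pointwise limits of continuous functions, so testing against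
continuous functions determines the integrals over closed sets. -/
lemma ae_eq_zero_of_forall_integral_continuousMap_mul {X : Type*} [PseudoEMetricSpace X]
    [CompactSpace X] [MeasurableSpace X] [BorelSpace X] {μ : Measure X} [IsFiniteMeasure μ]
    {f : X → ℂ} (hf : Integrable f μ) (h : ∀ φ : C(X, ℂ), ∫ x, φ x * f x ∂μ = 0) :
    f =ᵐ[μ] 0 := by
  refine ae_eq_zero_of_forall_setIntegral_isClosed_eq_zero hf fun s hs => ?_
  have hpos : ∀ n : ℕ, (0 : ℝ) < 1 / ((n : ℝ) + 1) := fun n => Nat.one_div_pos_of_nat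
  let φ : ℕ → C(X, ℂ) := fun n =>
    ⟨fun x => ((thickenedIndicator (hpos n) s x : ℝ) : ℂ), by fun_prop⟩
  have hlim : Filter.Tendsto (fun n => ∫ x, φ n x * f x ∂μ) Filter.atTop
      (nhds (∫ x, s.indicator f x ∂μ)) := by
    refine tendsto_integral_of_dominated_convergence (fun x => ‖f x‖) ?_ hf.norm ?_ ?_
    · intro n
      exact (integrable_continuousMap_mul hf (φ n)).aestronglyMeasurable
    · intro n
      refine ae_of_all _ fun x => ?_
      rw [norm_mul]
      refine mul_le_of_le_one_left (norm_nonneg _) ?_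
      have := thickenedIndicator_le_one (hpos n) s x
      simpa [φ] using this
    · refine ae_of_all _ fun x => ?_
      have h1 := tendsto_pi_nhds.1 (thickenedIndicator_tendsto_indicator_closure hpos
        tendsto_one_div_add_atTop_nhds_zero_nat s) x
      rw [hs.closure_eq] at h1
      have h2 : Filter.Tendsto (fun n => φ n x) Filter.atTop
          (nhds (((s.indicator (fun _ => (1 : ℝ≥0)) x : ℝ≥0) : ℝ) : ℂ)) :=
        (Complex.continuous_ofReal.tendsto _).comp ((NNReal.continuous_coe.tendsto _).comp h1)
      have h3 := h2.mul_const (f x)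
      convert h3 using 2
      by_cases hx : x ∈ s <;> simp [hx]
  simp only [h] at hlim
  rw [← integral_indicator hs.measurableSet]
  exact tendsto_nhds_unique hlim tendsto_const_nhds

lemma ae_eq_zero_of_mFourierCoeff_eq_zero {f : Torus d → ℂ} (hf : Integrable f (torusMeasure d))
    (h : ∀ k, UnitAddTorus.mFourierCoeff f k = 0) : f =ᵐ[torusMeasure d] 0 := by
  refine ae_eq_zero_of_forall_integral_continuousMap_mul hf fun φ => ?_
  let L : C(Torus d, ℂ) →L[ℂ] ℂ := LinearMap.mkContinuous
    { toFun := fun φ => ∫ x, φ x * f x ∂torusMeasure d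
      map_add' := fun φ ψ => by
        rw [← integral_add (integrable_continuousMap_mul hf φ) (integrable_continuousMap_mul hf ψ)]
        simp [add_mul]
      map_smul' := fun c φ => by
        simp [mul_assoc, integral_const_mul] }
    (∫ x, ‖f x‖ ∂torusMeasure d) (fun φ => by
      refine (norm_integral_le_integral_norm _).trans ?_
      rw [mul_comm, ← integral_const_mul]
      refine integral_mono (integrable_continuousMap_mul hf φ).norm (hf.norm.const_mul _) fun x => ?_
      simp only [norm_mul]
      exact mul_le_mul_of_nonneg_right (φ.norm_coe_le_norm x) (norm_nonneg _))
  have hspan : Submodule.span ℂ (Set.range (UnitAddTorus.mFourier (d := Fin d))) ≤ L.ker := by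
    rw [Submodule.span_le]
    rintro _ ⟨k, rfl⟩
    have := h (-k)
    rw [mFourierCoeff_eq_integral_torusMeasure, neg_neg] at this
    exact this
  have hcl := Submodule.topologicalClosure_minimal _ hspan L.isClosed_ker
  rw [UnitAddTorus.span_mFourier_closure_eq_top] at hcl
  exact hcl (Submodule.mem_top (x := φ))

lemma mFourierCoeff_add {f g : Torus d → ℂ} (hf : Integrable f (torusMeasure d))
    (hg : Integrable g (torusMeasure d)) (k : Fin d → ℤ) :
    UnitAddTorus.mFourierCoeff (f + g) k =
      UnitAddTorus.mFourierCoeff f k + UnitAddTorus.mFourierCoeff g k := by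
  simp only [mFourierCoeff_eq_integral_torusMeasure, Pi.add_apply, mul_add]
  exact integral_add (integrable_mFourier_mul hf _) (integrable_mFourier_mul hg _)

lemma mFourierCoeff_sub {f g : Torus d → ℂ} (hf : Integrable f (torusMeasure d))
    (hg : Integrable g (torusMeasure d)) (k : Fin d → ℤ) :
    UnitAddTorus.mFourierCoeff (f - g) k =
      UnitAddTorus.mFourierCoeff f k - UnitAddTorus.mFourierCoeff g k := by
  simp only [mFourierCoeff_eq_integral_torusMeasure, Pi.sub_apply, mul_sub]
  exact integral_sub (integrable_mFourier_mul hf _) (integrable_mFourier_mul hg _)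

/-- An integrable function on the torus is determined by its Fourier coefficients: the exponentials
span a dense subspace of `C(𝕋^d)`, and `C(𝕋^d)` separates integrable functions. -/
theorem ae_eq_of_mFourierCoeff_eq {f g : Torus d → ℂ} (hf : Integrable f (torusMeasure d))
    (hg : Integrable g (torusMeasure d))
    (h : ∀ k, UnitAddTorus.mFourierCoeff f k = UnitAddTorus.mFourierCoeff g k) :
    f =ᵐ[torusMeasure d] g := by
  have := ae_eq_zero_of_mFourierCoeff_eq_zero (hf.sub hg) fun k => by
    rw [mFourierCoeff_sub hf hg, h k, sub_self]
  filter_upwards [this] with x hx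
  simpa [sub_eq_zero] using hx

lemma mFourierCoeff_mFourier (l k : Fin d → ℤ) :
    UnitAddTorus.mFourierCoeff (UnitAddTorus.mFourier l) k = if k = l then 1 else 0 := by
  have h := (orthonormal_iff_ite.1 (UnitAddTorus.orthonormal_mFourier (d := Fin d))) k l
  rw [ContinuousMap.inner_toLp] at h
  rw [← h, mFourierCoeff_eq_integral_torusMeasure]
  refine integral_congr_ae (ae_of_all _ fun x => ?_)
  simp only [UnitAddTorus.mFourier_neg]
  ring

lemma enorm_mFourierCoeff_le_eLpNorm_one (f : Torus d → ℂ) (k : Fin d → ℤ) :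
    ‖UnitAddTorus.mFourierCoeff f k‖ₑ ≤ eLpNorm f 1 (torusMeasure d) := by
  rw [mFourierCoeff_eq_integral_torusMeasure, eLpNorm_one_eq_lintegral_enorm]
  refine (enorm_integral_le_lintegral_enorm _).trans_eq ?_
  refine lintegral_congr fun x => ?_
  rw [enorm_mul, ← ofReal_norm, norm_mFourier_apply]
  simp

lemma continuous_partialSum (n : Fin d → ℕ) (f : Torus d → ℂ) : Continuous (partialSum n f) := by
  unfold partialSum
  fun_prop

lemma integrable_partialSum (n : Fin d → ℕ) (f : Torus d → ℂ) :
    Integrable (partialSum n f) (torusMeasure d) :=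
  (continuous_partialSum n f).integrable_of_hasCompactSupport (HasCompactSupport.of_compactSpace _)

lemma mFourierCoeff_partialSum (n : Fin d → ℕ) (f : Torus d → ℂ) (k : Fin d → ℤ) :
    UnitAddTorus.mFourierCoeff (partialSum n f) k =
      (∏ i, if |k i| ≤ (n i : ℤ) then 1 else 0) * UnitAddTorus.mFourierCoeff f k := by
  have h1 : ∀ l : Fin d → ℤ, Integrable (fun x => UnitAddTorus.mFourier (-k) x *
      (UnitAddTorus.mFourierCoeff f l * UnitAddTorus.mFourier l x)) (torusMeasure d) := fun l =>
    Continuous.integrable_of_hasCompactSupport (by fun_prop) (HasCompactSupport.of_compactSpace _)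
  have h2 : ∀ l : Fin d → ℤ, ∫ x, UnitAddTorus.mFourier (-k) x *
      (UnitAddTorus.mFourierCoeff f l * UnitAddTorus.mFourier l x) ∂torusMeasure d =
        if k = l then UnitAddTorus.mFourierCoeff f l else 0 := fun l => by
    simp_rw [mul_left_comm]
    rw [integral_const_mul, ← mFourierCoeff_eq_integral_torusMeasure, mFourierCoeff_mFourier,
      mul_ite, mul_one, mul_zero]
  rw [mFourierCoeff_eq_integral_torusMeasure]
  simp only [partialSum, Finset.mul_sum]
  rw [integral_finsetSum _ fun l _ => h1 l]
  simp only [h2, Finset.sum_ite_eq, Fintype.mem_piFinset, Finset.mem_Icc, ← abs_le]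
  rw [Finset.prod_ite_zero]
  simp

/-! ### Convolution in one coordinate -/

/-- Convolution of `g` with `φ` in the coordinate `j`:
`x ↦ ∫ φ(t) g(x - t e_j) dt`, with the normalized Haar measure on the circle. -/
def partialConv (j : Fin d) (φ : UnitAddCircle → ℂ) (g : Torus d → ℂ) (x : Torus d) : ℂ :=
  ∫ t, φ t * g (x - Pi.single j t) ∂AddCircle.haarAddCircle

lemma measurePreserving_sub_single (j : Fin d) :
    MeasurePreserving (fun p : UnitAddCircle × Torus d => (p.1, p.2 - Pi.single j p.1))
      (AddCircle.haarAddCircle.prod (torusMeasure d))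
      (AddCircle.haarAddCircle.prod (torusMeasure d)) := by
  refine (MeasurePreserving.id (AddCircle.haarAddCircle (T := 1))).skew_product
    (μc := torusMeasure d) (μd := torusMeasure d)
    (g := fun (t : UnitAddCircle) (x : Torus d) => x - Pi.single j t) ?_ ?_
  · have : Continuous fun p : UnitAddCircle × Torus d => p.2 - Pi.single j p.1 :=
      continuous_snd.sub ((continuous_single j).comp continuous_fst)
    exact this.measurable
  · exact ae_of_all _ fun t => (measurePreserving_sub_right (torusMeasure d) _).map_eq

lemma integrable_partialConv_integrand (j : Fin d) {φ : UnitAddCircle → ℂ} {g : Torus d → ℂ}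
    (hφ : Integrable φ AddCircle.haarAddCircle) (hg : Integrable g (torusMeasure d)) :
    Integrable (fun p : UnitAddCircle × Torus d => φ p.1 * g (p.2 - Pi.single j p.1))
      (AddCircle.haarAddCircle.prod (torusMeasure d)) :=
  (measurePreserving_sub_single j).integrable_comp_of_integrable (hφ.mul_prod hg)

lemma integrable_partialConv (j : Fin d) {φ : UnitAddCircle → ℂ} {g : Torus d → ℂ}
    (hφ : Integrable φ AddCircle.haarAddCircle) (hg : Integrable g (torusMeasure d)) :
    Integrable (partialConv j φ g) (torusMeasure d) :=
  (integrable_partialConv_integrand j hφ hg).integral_prod_right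

lemma mFourier_add_single (k : Fin d → ℤ) (x : Torus d) (j : Fin d) (t : UnitAddCircle) :
    UnitAddTorus.mFourier k (x + Pi.single j t) =
      UnitAddTorus.mFourier k x * fourier (k j) t := by
  simp only [UnitAddTorus.mFourier, ContinuousMap.coe_mk, Pi.add_apply]
  have h : ∀ i, fourier (k i) (x i + Pi.single (M := fun _ => UnitAddCircle) j t i) =
      fourier (k i) (x i) * if i = j then fourier (k j) t else 1 := by
    intro i
    by_cases hi : i = j
    · subst hi
      simp [fourier_apply, smul_add, AddCircle.toCircle_add]
    · simp [hi]
  simp only [h, Finset.prod_mul_distrib, Finset.prod_ite_eq', Finset.mem_univ, if_true]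

lemma integrable_mFourier_mul_partialConv_integrand (j : Fin d) {φ : UnitAddCircle → ℂ}
    {g : Torus d → ℂ} (hφ : Integrable φ AddCircle.haarAddCircle)
    (hg : Integrable g (torusMeasure d)) (k : Fin d → ℤ) :
    Integrable (fun p : UnitAddCircle × Torus d => UnitAddTorus.mFourier (-k) p.2 *
      (φ p.1 * g (p.2 - Pi.single j p.1))) (AddCircle.haarAddCircle.prod (torusMeasure d)) := by
  have hc : Continuous fun p : UnitAddCircle × Torus d => UnitAddTorus.mFourier (-k) p.2 :=
    (UnitAddTorus.mFourier (-k)).continuous.comp continuous_snd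
  exact (integrable_partialConv_integrand j hφ hg).bdd_mul (c := 1) hc.aestronglyMeasurable
    (ae_of_all _ fun p => (norm_mFourier_apply _ _).le)

lemma integral_mFourier_mul_translate (j : Fin d) {φ : UnitAddCircle → ℂ} {g : Torus d → ℂ}
    (k : Fin d → ℤ) (t : UnitAddCircle) :
    ∫ x, UnitAddTorus.mFourier (-k) x * (φ t * g (x - Pi.single j t)) ∂torusMeasure d =
      fourier (-(k j)) t * φ t * UnitAddTorus.mFourierCoeff g k := by
  rw [← integral_add_right_eq_self _ (Pi.single j t : Torus d),
    mFourierCoeff_eq_integral_torusMeasure, ← integral_const_mul]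
  refine integral_congr_ae (ae_of_all _ fun x => ?_)
  beta_reduce
  rw [add_sub_cancel_right, mFourier_add_single, Pi.neg_apply]
  ring

lemma mFourierCoeff_partialConv (j : Fin d) {φ : UnitAddCircle → ℂ} {g : Torus d → ℂ}
    (hφ : Integrable φ AddCircle.haarAddCircle) (hg : Integrable g (torusMeasure d))
    (k : Fin d → ℤ) :
    UnitAddTorus.mFourierCoeff (partialConv j φ g) k =
      fourierCoeff φ (k j) * UnitAddTorus.mFourierCoeff g k := by
  have hint : Integrable (Function.uncurry fun (x : Torus d) (t : UnitAddCircle) =>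
      UnitAddTorus.mFourier (-k) x * (φ t * g (x - Pi.single j t)))
      ((torusMeasure d).prod AddCircle.haarAddCircle) := by
    have := (integrable_mFourier_mul_partialConv_integrand j hφ hg k).swap
    rw [Function.comp_def] at this
    exact this
  have hswap := integral_integral_swap hint
  calc _ = ∫ x, ∫ t, UnitAddTorus.mFourier (-k) x * (φ t * g (x - Pi.single j t))
          ∂AddCircle.haarAddCircle ∂torusMeasure d := by
        rw [mFourierCoeff_eq_integral_torusMeasure]
        simp only [partialConv, ← integral_const_mul]
    _ = ∫ t, fourier (-(k j)) t * φ t * UnitAddTorus.mFourierCoeff g k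
          ∂AddCircle.haarAddCircle := by
        rw [hswap]
        exact integral_congr_ae (ae_of_all _ fun t => integral_mFourier_mul_translate j k t)
    _ = _ := by
        rw [integral_mul_const]
        rfl

/-- Jensen's inequality for the measure with density `a`, which need not have mass one. -/
lemma lintegral_mul_rpow_le {X : Type*} [MeasurableSpace X] {μ : Measure X} {a b : X → ℝ≥0∞}
    (ha : AEMeasurable a μ) (hb : AEMeasurable b μ) {p : ℝ} (hp : 1 < p) :
    (∫⁻ t, a t * b t ∂μ) ^ p ≤ (∫⁻ t, a t ∂μ) ^ (p - 1) * ∫⁻ t, a t * b t ^ p ∂μ := by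
  have hpq : (Real.conjExponent p).HolderConjugate p := (Real.HolderConjugate.conjExponent hp).symm
  set p' := Real.conjExponent p
  have hp0 : 0 < p := hpq.symm.pos
  have hp'0 : 0 < p' := hpq.pos
  have hsum : 1 / p' + 1 / p = 1 := by simpa using hpq.inv_add_inv_eq_one
  have hfac : ∀ t, a t * b t = a t ^ (1 / p') * (a t ^ (1 / p) * b t) := fun t => by
    rw [← mul_assoc, ← ENNReal.rpow_add_of_nonneg _ _ (by positivity) (by positivity), hsum,
      ENNReal.rpow_one]
  have hH := ENNReal.lintegral_mul_le_Lp_mul_Lq μ hpq (ha.pow_const (1 / p'))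
    ((ha.pow_const (1 / p)).mul hb)
  simp only [Pi.mul_apply, ← hfac, ENNReal.mul_rpow_of_nonneg _ _ hp0.le, ← ENNReal.rpow_mul,
    one_div_mul_cancel hp0.ne', one_div_mul_cancel hp'0.ne', ENNReal.rpow_one] at hH
  refine (ENNReal.rpow_le_rpow hH hp0.le).trans_eq ?_
  rw [ENNReal.mul_rpow_of_nonneg _ _ hp0.le, ← ENNReal.rpow_mul, ← ENNReal.rpow_mul,
    one_div_mul_cancel hp0.ne', ENNReal.rpow_one]
  congr 2
  have : 1 / p' = 1 - 1 / p := by linarith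
  rw [this]
  field_simp

/-- **Young's inequality** for convolution in one coordinate. -/
theorem eLpNorm_partialConv_le (j : Fin d) {φ : UnitAddCircle → ℂ} {g : Torus d → ℂ}
    (hφ : Integrable φ AddCircle.haarAddCircle) (hg : Integrable g (torusMeasure d))
    {q : ℝ} (hq : 1 < q) :
    eLpNorm (partialConv j φ g) (ENNReal.ofReal q) (torusMeasure d) ≤
      eLpNorm φ 1 AddCircle.haarAddCircle * eLpNorm g (ENNReal.ofReal q) (torusMeasure d) := by
  have hq0 : 0 < q := by linarith
  have hne : ENNReal.ofReal q ≠ 0 := by simpa using hq0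
  set A := eLpNorm φ 1 AddCircle.haarAddCircle with hA
  rw [eLpNorm_one_eq_lintegral_enorm] at hA
  set s : UnitAddCircle → Torus d := fun t => Pi.single j t with hs
  have hmeas : AEMeasurable (fun p : UnitAddCircle × Torus d => ‖φ p.1‖ₑ * ‖g (p.2 - s p.1)‖ₑ ^ q)
      (AddCircle.haarAddCircle.prod (torusMeasure d)) := by
    have h1 := (measurePreserving_sub_single j).quasiMeasurePreserving
    have h2 : AEMeasurable (fun p : UnitAddCircle × Torus d => ‖g p.2‖ₑ ^ q)
      (AddCircle.haarAddCircle.prod (torusMeasure d)) :=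
        (hg.aestronglyMeasurable.comp_snd.enorm.pow_const q)
    exact hφ.aestronglyMeasurable.comp_fst.enorm.mul (h2.comp_quasiMeasurePreserving h1)
  have hgt : ∀ᵐ x ∂torusMeasure d,
      AEMeasurable (fun t => ‖g (x - s t)‖ₑ) AddCircle.haarAddCircle := by
    have h1 : AEStronglyMeasurable (fun p : UnitAddCircle × Torus d => g (p.2 - s p.1))
        (AddCircle.haarAddCircle.prod (torusMeasure d)) :=
      hg.aestronglyMeasurable.comp_snd.comp_quasiMeasurePreserving
        (measurePreserving_sub_single j).quasiMeasurePreserving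
    filter_upwards [h1.prod_swap.prodMk_left] with x hx
    exact hx.enorm
  have hpt : ∀ᵐ x ∂torusMeasure d, ‖partialConv j φ g x‖ₑ ^ q ≤
      A ^ (q - 1) * ∫⁻ t, ‖φ t‖ₑ * ‖g (x - s t)‖ₑ ^ q ∂AddCircle.haarAddCircle := by
    filter_upwards [hgt] with x hx
    refine le_trans (ENNReal.rpow_le_rpow (enorm_integral_le_lintegral_enorm _) hq0.le) ?_
    simp only [enorm_mul]
    rw [hA]
    exact lintegral_mul_rpow_le hφ.aestronglyMeasurable.enorm hx hq
  have hpow : ∫⁻ x, ‖partialConv j φ g x‖ₑ ^ q ∂torusMeasure d ≤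
      A ^ q * ∫⁻ x, ‖g x‖ₑ ^ q ∂torusMeasure d := by
    refine (lintegral_mono_ae hpt).trans ?_
    rw [lintegral_const_mul' _ _ (ENNReal.rpow_ne_top_of_nonneg (by linarith) ?_)]
    · rw [lintegral_lintegral_swap hmeas.prod_swap]
      have h3 : ∀ t, ∫⁻ x, ‖φ t‖ₑ * ‖g (x - s t)‖ₑ ^ q ∂torusMeasure d =
          ‖φ t‖ₑ * ∫⁻ x, ‖g x‖ₑ ^ q ∂torusMeasure d := fun t => by
        rw [lintegral_const_mul' _ _ enorm_ne_top,
          lintegral_sub_right_eq_self (fun x => ‖g x‖ₑ ^ q)]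
      simp only [h3]
      rw [lintegral_mul_const'' _ hφ.aestronglyMeasurable.enorm, ← hA, ← mul_assoc]
      refine mul_le_mul_left (le_of_eq ?_) _
      conv_rhs => rw [show q = (q - 1) + 1 by ring]
      rw [ENNReal.rpow_add_of_nonneg _ _ (by linarith) zero_le_one, ENNReal.rpow_one]
    · rw [hA]
      exact hφ.hasFiniteIntegral.ne
  rw [eLpNorm_eq_lintegral_rpow_enorm_toReal hne ENNReal.ofReal_ne_top,
    eLpNorm_eq_lintegral_rpow_enorm_toReal hne ENNReal.ofReal_ne_top, ENNReal.toReal_ofReal hq0.le]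
  refine (ENNReal.rpow_le_rpow hpow (by positivity)).trans_eq ?_
  rw [ENNReal.mul_rpow_of_nonneg _ _ (by positivity), ← ENNReal.rpow_mul,
    mul_one_div_cancel hq0.ne', ENNReal.rpow_one]

/-! ### Fourier coefficients of the weak gradient -/

lemma isTestFunction_mFourier (k : Fin d → ℤ) :
    IsTestFunction (UnitAddTorus.mFourier k : Torus d → ℂ) := by
  unfold IsTestFunction
  simp only [UnitAddTorus.mFourier, ContinuousMap.coe_mk, fourier_coe_apply]
  refine contDiff_prod fun i _ => ?_
  have h : ContDiff ℝ ∞ fun x : Fin d → ℝ => ((x i : ℝ) : ℂ) :=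
    Complex.ofRealCLM.contDiff.comp (contDiff_apply ℝ ℝ i)
  exact Complex.contDiff_exp.comp ((contDiff_const.mul h).div_const _)

lemma partialDeriv_mFourier (j : Fin d) (k : Fin d → ℤ) (x : Torus d) :
    partialDeriv j (UnitAddTorus.mFourier k) x =
      2 * Real.pi * Complex.I * k j * UnitAddTorus.mFourier k x := by
  unfold partialDeriv
  simp only [mFourier_add_single]
  have h := (hasDerivAt_fourier 1 (k j) 0).const_mul (UnitAddTorus.mFourier k x)
  rw [h.deriv]
  simp
  ring

lemma IsWeakGradient.integrable_apply {f : Torus d → ℂ} {G : Torus d → EuclideanSpace ℂ (Fin d)}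
    (h : IsWeakGradient f G) (j : Fin d) : Integrable (fun x => G x j) (torusMeasure d) :=
  (EuclideanSpace.proj (𝕜 := ℂ) j : EuclideanSpace ℂ (Fin d) →L[ℂ] ℂ).integrable_comp h.2.1

lemma IsWeakGradient.mFourierCoeff_apply {f : Torus d → ℂ}
    {G : Torus d → EuclideanSpace ℂ (Fin d)} (h : IsWeakGradient f G) (j : Fin d)
    (k : Fin d → ℤ) :
    UnitAddTorus.mFourierCoeff (fun x => G x j) k =
      2 * Real.pi * Complex.I * k j * UnitAddTorus.mFourierCoeff f k := by
  have h1 := h.2.2 j (UnitAddTorus.mFourier (-k)) (isTestFunction_mFourier (-k))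
  simp only [partialDeriv_mFourier] at h1
  rw [mFourierCoeff_eq_integral_torusMeasure, mFourierCoeff_eq_integral_torusMeasure,
    ← integral_const_mul]
  rw [eq_neg_iff_add_eq_zero, add_comm, ← eq_neg_iff_add_eq_zero, ← integral_neg] at h1
  simp only [mul_comm (UnitAddTorus.mFourier (-k) _) (G _ j)]
  rw [h1]
  refine integral_congr_ae (ae_of_all _ fun x => ?_)
  simp only [Pi.neg_apply, Int.cast_neg]
  ring

lemma eLpNorm_apply_le (G : Torus d → EuclideanSpace ℂ (Fin d)) (j : Fin d) (p : ℝ≥0∞) :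
    eLpNorm (fun x => G x j) p (torusMeasure d) ≤ eLpNorm G p (torusMeasure d) :=
  eLpNorm_mono fun x => PiLp.norm_apply_le (G x) j

/-! ### The Dirichlet kernel and the tail of the sawtooth kernel -/

/-- The Dirichlet kernel `D_n(x) = ∑_{|l| ≤ n} e^{2π i l x}` on the circle. -/
def dirichletKernel (n : ℕ) (x : UnitAddCircle) : ℂ :=
  ∑ l ∈ Finset.Icc (-(n : ℤ)) n, fourier l x

lemma continuous_dirichletKernel (n : ℕ) : Continuous (dirichletKernel n) := by
  unfold dirichletKernel
  fun_prop

lemma integrable_dirichletKernel (n : ℕ) :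
    Integrable (dirichletKernel n) AddCircle.haarAddCircle :=
  (continuous_dirichletKernel n).integrable_of_hasCompactSupport
    (HasCompactSupport.of_compactSpace _)

lemma fourierCoeff_dirichletKernel (n : ℕ) (l : ℤ) :
    fourierCoeff (dirichletKernel n) l = if |l| ≤ n then 1 else 0 := by
  have h1 : dirichletKernel n =
      ∑ l ∈ Finset.Icc (-(n : ℤ)) n, ⇑(fourier l : C(UnitAddCircle, ℂ)) := by
    ext x
    simp [dirichletKernel]
  rw [h1, fourierCoeff.sum]
  · simp only [fourierCoeff_fourier, Finset.sum_apply, Pi.single_apply, Finset.sum_ite_eq,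
      Finset.mem_Icc, abs_le]
  · exact fun i _ => (fourier i).continuous.integrable_of_hasCompactSupport
      (HasCompactSupport.of_compactSpace _)

lemma norm_dirichletKernel_le (n : ℕ) (x : UnitAddCircle) :
    ‖dirichletKernel n x‖ ≤ 2 * n + 1 := by
  refine (norm_sum_le_of_le _ (n := fun _ => 1) fun l _ => ?_).trans_eq ?_
  · rw [fourier_apply, Circle.norm_coe]
  · simp only [Finset.sum_const, Int.card_Icc, nsmul_eq_mul, mul_one]
    have : ((n : ℤ) + 1 - -(n : ℤ)).toNat = 2 * n + 1 := by omega
    rw [this]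
    push_cast
    ring

lemma dirichletKernel_mul_fourier_sub_one (n : ℕ) (x : UnitAddCircle) :
    dirichletKernel n x * (fourier 1 x - 1) = fourier (n + 1 : ℤ) x - fourier (-n : ℤ) x := by
  induction n with
  | zero => simp [dirichletKernel]
  | succ n ih =>
    have h1 : Finset.Icc (-((n + 1 : ℕ) : ℤ)) ((n + 1 : ℕ) : ℤ) =
        insert (-((n : ℤ) + 1)) (insert ((n : ℤ) + 1) (Finset.Icc (-(n : ℤ)) n)) := by
      ext l
      simp only [Finset.mem_Icc, Finset.mem_insert]
      omega
    have h2 : dirichletKernel (n + 1) x =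
        fourier (-((n : ℤ) + 1)) x + (fourier ((n : ℤ) + 1) x + dirichletKernel n x) := by
      rw [dirichletKernel, h1, Finset.sum_insert, Finset.sum_insert, dirichletKernel]
      · simp
      · simp only [Finset.mem_Icc, Finset.mem_insert]
        omega
    have h3 : (fourier (-n : ℤ) x : ℂ) = fourier (-((n : ℤ) + 1)) x * fourier 1 x := by
      rw [← fourier_add]
      congr 2
      ring
    have h4 : (fourier (((n + 1 : ℕ) : ℤ) + 1) x : ℂ) = fourier ((n : ℤ) + 1) x * fourier 1 x := by
      rw [← fourier_add]
      push_cast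
      rfl
    have h5 : (fourier (-((n + 1 : ℕ) : ℤ)) x : ℂ) = fourier (-((n : ℤ) + 1)) x := by
      push_cast
      rfl
    rw [h2, h4, h5, add_mul, add_mul, ih, h3]
    ring

lemma four_mul_abs_le_norm_fourier_one_sub_one {x : ℝ} (hx : |x| ≤ 1 / 2) :
    4 * |x| ≤ ‖fourier 1 (x : UnitAddCircle) - 1‖ := by
  have h1 : (fourier 1 (x : UnitAddCircle) : ℂ) =
      Complex.exp (Complex.I * ((2 * Real.pi * x : ℝ) : ℂ)) := by
    rw [fourier_coe_apply]
    congr 1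
    push_cast
    ring
  rw [h1, Complex.norm_exp_I_mul_ofReal_sub_one, norm_mul, Real.norm_eq_abs, Real.norm_eq_abs,
    show 2 * Real.pi * x / 2 = Real.pi * x by ring]
  have hpi := Real.pi_pos
  have h2 := Real.mul_abs_le_abs_sin (x := Real.pi * x) (by
    rw [abs_mul, abs_of_pos hpi]
    nlinarith)
  rw [abs_mul, abs_of_pos hpi, ← mul_assoc, div_mul_cancel₀ _ hpi.ne'] at h2
  rw [abs_of_pos (by norm_num : (0 : ℝ) < 2)]
  linarith

lemma norm_dirichletKernel_coe_le (n : ℕ) {x : ℝ} (hx : |x| ≤ 1 / 2) (h0 : x ≠ 0) :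
    ‖dirichletKernel n x‖ ≤ |x|⁻¹ := by
  have h1 : ‖dirichletKernel n x‖ * ‖fourier 1 (x : UnitAddCircle) - 1‖ ≤ 2 := by
    rw [← norm_mul, dirichletKernel_mul_fourier_sub_one]
    refine (norm_sub_le _ _).trans ?_
    rw [fourier_apply, fourier_apply, Circle.norm_coe, Circle.norm_coe]
    norm_num
  have h2 := four_mul_abs_le_norm_fourier_one_sub_one hx
  have h3 : 0 < |x| := abs_pos.2 h0
  rw [← one_div, le_div_iff₀ h3]
  nlinarith [mul_le_mul_of_nonneg_left h2 (norm_nonneg (dirichletKernel n x)),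
    mul_nonneg (norm_nonneg (dirichletKernel n x)) h3.le]

lemma norm_dirichletKernel_coe_le_rpow {ε : ℝ} (hε : 0 < ε) (hε1 : ε ≤ 1) (n : ℕ) {x : ℝ}
    (hx : |x| ≤ 1 / 2) (h0 : x ≠ 0) :
    ‖dirichletKernel n x‖ ≤ (2 * n + 1 : ℝ) ^ ε * |x| ^ (-(1 - ε)) := by
  rcases (norm_nonneg (dirichletKernel n x)).eq_or_lt with h | h
  · rw [← h]
    positivity
  -- interpolate between the bounds `2n + 1` and `|x|⁻¹`
  have h1 : ‖dirichletKernel n x‖ =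
      ‖dirichletKernel n x‖ ^ ε * ‖dirichletKernel n x‖ ^ (1 - ε) := by
    rw [← Real.rpow_add h, add_sub_cancel, Real.rpow_one]
  rw [h1, Real.rpow_neg (abs_nonneg x), ← Real.inv_rpow (abs_nonneg x)]
  gcongr
  · exact norm_dirichletKernel_le n x
  · exact norm_dirichletKernel_coe_le n hx h0

/-- The Lebesgue constants grow more slowly than any positive power of `n`. -/
theorem exists_eLpNorm_dirichletKernel_le {ε : ℝ} (hε : 0 < ε) (hε1 : ε ≤ 1) :
    ∃ C : ℝ≥0, ∀ n : ℕ, 1 ≤ n →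
      eLpNorm (dirichletKernel n) 1 AddCircle.haarAddCircle ≤ C * (n : ℝ≥0∞) ^ ε := by
  have hint : IntegrableOn (fun x : ℝ => |x| ^ (-(1 - ε))) (Set.Ioc (-(1 / 2)) (-(1 / 2) + 1)) := by
    have hball : IntegrableOn (fun x : ℝ => |x| ^ (-(1 - ε))) (Metric.ball 0 1) := by
      refine integrableOn_ball_of_norm_le_rpow (C := 1) (α := 1 - ε) (by simp) (by simpa using hε)
        (ae_of_all _ fun x => ?_) (continuous_abs.measurable.pow_const _).aestronglyMeasurable
      rw [one_mul, Real.norm_eq_abs, Real.norm_eq_abs, abs_of_nonneg (by positivity)]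
    refine hball.mono_set fun x hx => ?_
    rw [mem_ball_zero_iff, Real.norm_eq_abs, abs_lt]
    constructor <;> linarith [hx.1, hx.2]
  set I : ℝ≥0∞ := ∫⁻ x in Set.Ioc (-(1 / 2) : ℝ) (-(1 / 2) + 1), ENNReal.ofReal (|x| ^ (-(1 - ε)))
    with hI
  have hIfin : I ≠ ⊤ := by
    have h := hint.hasFiniteIntegral.ne
    convert h using 1
    refine lintegral_congr fun x => ?_
    rw [Real.enorm_of_nonneg (by positivity)]
  refine ⟨I.toNNReal * 3, fun n hn => ?_⟩
  have h1 : eLpNorm (dirichletKernel n) 1 AddCircle.haarAddCircle =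
      ∫⁻ x in Set.Ioc (-(1 / 2) : ℝ) (-(1 / 2) + 1), ‖dirichletKernel n x‖ₑ := by
    rw [eLpNorm_one_eq_lintegral_enorm,
      UnitAddCircle.lintegral_preimage (-(1 / 2)) fun x => ‖dirichletKernel n x‖ₑ,
      AddCircle.volume_eq_smul_haarAddCircle]
    simp
  have h2 : ∀ᵐ x : ℝ ∂volume.restrict (Set.Ioc (-(1 / 2) : ℝ) (-(1 / 2) + 1)),
      ‖dirichletKernel n x‖ₑ ≤
        ENNReal.ofReal ((2 * n + 1 : ℝ) ^ ε) * ENNReal.ofReal (|x| ^ (-(1 - ε))) := by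
    filter_upwards [ae_restrict_mem measurableSet_Ioc,
      ae_restrict_of_ae (Measure.ae_ne (volume : Measure ℝ) 0)] with x hx h0
    rw [← ENNReal.ofReal_mul (by positivity), ← ofReal_norm]
    refine ENNReal.ofReal_le_ofReal (norm_dirichletKernel_coe_le_rpow hε hε1 n ?_ h0)
    rw [abs_le]
    constructor <;> linarith [hx.1, hx.2]
  have h3 : ENNReal.ofReal ((2 * n + 1 : ℝ) ^ ε) ≤ 3 * (n : ℝ≥0∞) ^ ε := by
    have hn' : (1 : ℝ) ≤ n := by exact_mod_cast hn
    have h4 : (2 * n + 1 : ℝ) ^ ε ≤ 3 * (n : ℝ) ^ ε :=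
      calc (2 * n + 1 : ℝ) ^ ε ≤ (3 * n : ℝ) ^ ε := by
            gcongr
            linarith
        _ = 3 ^ ε * (n : ℝ) ^ ε := Real.mul_rpow (by norm_num) (by positivity)
        _ ≤ 3 * (n : ℝ) ^ ε := by
            gcongr
            exact (Real.rpow_le_rpow_of_exponent_le (by norm_num) hε1).trans_eq (Real.rpow_one 3)
    refine (ENNReal.ofReal_le_ofReal h4).trans_eq ?_
    rw [ENNReal.ofReal_mul (by norm_num), ← ENNReal.ofReal_rpow_of_nonneg (by positivity) hε.le,
      ENNReal.ofReal_natCast]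
    norm_num
  rw [h1]
  refine (lintegral_mono_ae h2).trans ?_
  rw [lintegral_const_mul' _ _ ENNReal.ofReal_ne_top, ← hI, ENNReal.coe_mul,
    ENNReal.coe_toNNReal hIfin, mul_assoc, mul_comm]
  exact mul_le_mul_right h3 I

/-- Coefficients `1 / (2π i l)` for `|l| > n` and `0` otherwise: those of the sawtooth function with
its Fourier partial sum of order `n` removed. -/
def sawtoothTailCoeff (n : ℕ) (l : ℤ) : ℂ :=
  if |l| ≤ n then 0 else (2 * Real.pi * Complex.I * l)⁻¹

/-- Splitting `|l|⁻²` as `|l|^{-1/2} |l|^{-3/2}` gives decay in `n` from the first factor and keeps the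
second one summable over `l`. -/
lemma norm_sawtoothTailCoeff_sq_le {n : ℕ} (hn : 1 ≤ n) (l : ℤ) :
    ‖sawtoothTailCoeff n l‖ ^ (2 : ℝ) ≤ (n : ℝ) ^ (-(1 / 2) : ℝ) * |(l : ℝ)| ^ (-(3 / 2) : ℝ) := by
  unfold sawtoothTailCoeff
  split_ifs with h
  · simp only [norm_zero]
    rw [Real.zero_rpow (by norm_num)]
    positivity
  · have hn0 : (0 : ℝ) < n := by exact_mod_cast hn
    have h1 : (n : ℝ) ≤ |(l : ℝ)| := by
      rw [← Int.cast_abs]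
      exact_mod_cast (not_le.1 h).le
    have hl : 0 < |(l : ℝ)| := hn0.trans_le h1
    have h2 : ‖(2 * Real.pi * Complex.I * l : ℂ)⁻¹‖ ≤ |(l : ℝ)|⁻¹ := by
      rw [norm_inv]
      refine inv_anti₀ hl ?_
      simp only [norm_mul, Complex.norm_ofNat, Complex.norm_real, Complex.norm_I, mul_one,
        Complex.norm_intCast, Real.norm_eq_abs, abs_of_pos Real.pi_pos]
      nlinarith [Real.pi_gt_three]
    calc ‖(2 * Real.pi * Complex.I * l : ℂ)⁻¹‖ ^ (2 : ℝ) ≤ (|(l : ℝ)|⁻¹) ^ (2 : ℝ) := by gcongr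
      _ = |(l : ℝ)| ^ (-(1 / 2) : ℝ) * |(l : ℝ)| ^ (-(3 / 2) : ℝ) := by
          rw [← Real.rpow_neg_one, ← Real.rpow_mul hl.le, ← Real.rpow_add hl]
          norm_num
      _ ≤ _ := by
          refine mul_le_mul_of_nonneg_right ?_ (by positivity)
          exact Real.rpow_le_rpow_of_nonpos hn0 h1 (by norm_num)

/-- There are kernels with the Fourier coefficients `sawtoothTailCoeff n` and `L¹` norm
`O(n^{-1/4})`. Convolution with them turns a derivative of `f` into `f` minus its partial sum. -/
theorem exists_sawtoothTail :
    ∃ C : ℝ≥0, ∀ n : ℕ, 1 ≤ n → ∃ K : UnitAddCircle → ℂ, Integrable K AddCircle.haarAddCircle ∧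
      (∀ l, fourierCoeff K l = sawtoothTailCoeff n l) ∧
      eLpNorm K 1 AddCircle.haarAddCircle ≤ C * (n : ℝ≥0∞) ^ (-(1 / 4) : ℝ) := by
  have hsum : Summable fun l : ℤ => |(l : ℝ)| ^ (-(3 / 2) : ℝ) :=
    Real.summable_abs_int_rpow (by norm_num)
  set A := ∑' l : ℤ, |(l : ℝ)| ^ (-(3 / 2) : ℝ) with hA
  have hA0 : 0 ≤ A := tsum_nonneg fun l => by positivity
  refine ⟨(A ^ (1 / 2 : ℝ)).toNNReal, fun n hn => ?_⟩
  have hle := norm_sawtoothTailCoeff_sq_le hn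
  have hs : Summable fun l => ‖sawtoothTailCoeff n l‖ ^ (2 : ℝ) :=
    (hsum.mul_left _).of_nonneg_of_le (fun l => by positivity) hle
  let a : lp (fun _ : ℤ => ℂ) 2 := ⟨sawtoothTailCoeff n, memℓp_gen (by simpa using hs)⟩
  have ha : ‖a‖ ≤ A ^ (1 / 2 : ℝ) * (n : ℝ) ^ (-(1 / 4) : ℝ) := by
    have h1 := lp.norm_rpow_eq_tsum (p := 2) (by simp) a
    have h2 : ‖a‖ ^ (2 : ℝ) ≤ (n : ℝ) ^ (-(1 / 2) : ℝ) * A := by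
      rw [hA, ← tsum_mul_left]
      simp only [ENNReal.toReal_ofNat] at h1
      rw [h1]
      exact hs.tsum_le_tsum hle (hsum.mul_left _)
    have h3 := Real.rpow_le_rpow (by positivity) h2 (by norm_num : (0 : ℝ) ≤ 1 / 2)
    rw [← Real.rpow_mul (norm_nonneg _), Real.mul_rpow (by positivity) hA0,
      ← Real.rpow_mul (by positivity)] at h3
    norm_num at h3 ⊢
    linarith
  let K := (fourierBasis (T := 1)).repr.symm a
  refine ⟨K, (Lp.memLp K).integrable (by norm_num), fun l => ?_, ?_⟩
  · rw [← fourierBasis_repr]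
    simp only [K, LinearIsometryEquiv.apply_symm_apply]
    rfl
  · calc eLpNorm K 1 AddCircle.haarAddCircle ≤ eLpNorm K 2 AddCircle.haarAddCircle :=
          eLpNorm_le_eLpNorm_of_exponent_le (by norm_num) (Lp.aestronglyMeasurable K)
      _ = ENNReal.ofReal ‖a‖ := by
          rw [← LinearIsometryEquiv.norm_map (fourierBasis (T := 1)).repr.symm a, Lp.norm_def,
            ENNReal.ofReal_toReal (Lp.eLpNorm_ne_top _)]
      _ ≤ ENNReal.ofReal (A ^ (1 / 2 : ℝ) * (n : ℝ) ^ (-(1 / 4) : ℝ)) :=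
          ENNReal.ofReal_le_ofReal ha
      _ = _ := by
          rw [ENNReal.ofReal_mul (by positivity),
            ← ENNReal.ofReal_rpow_of_pos (x := (n : ℝ)) (by exact_mod_cast hn),
            ENNReal.ofReal_natCast]
          rfl

/-! ### Rectangular partial sums -/

/-- Truncation to `|k_i| ≤ n_i` in the coordinates `i ∈ S`, at the cost of the Lebesgue constants. -/
lemma exists_rectangular_truncation {g : Torus d → ℂ} (hg : Integrable g (torusMeasure d))
    {q : ℝ} (hq : 1 < q) (n : Fin d → ℕ) (S : Finset (Fin d)) :
    ∃ h : Torus d → ℂ, Integrable h (torusMeasure d) ∧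
      (∀ k, UnitAddTorus.mFourierCoeff h k =
        (∏ i ∈ S, if |k i| ≤ (n i : ℤ) then 1 else 0) * UnitAddTorus.mFourierCoeff g k) ∧
      eLpNorm h (ENNReal.ofReal q) (torusMeasure d) ≤
        (∏ i ∈ S, eLpNorm (dirichletKernel (n i)) 1 AddCircle.haarAddCircle) *
          eLpNorm g (ENNReal.ofReal q) (torusMeasure d) := by
  classical
  induction S using Finset.induction_on with
  | empty => exact ⟨g, hg, by simp, by simp⟩
  | insert a S ha ih =>
    obtain ⟨h, hint, hcoeff, hnorm⟩ := ih
    have hD := integrable_dirichletKernel (n a)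
    refine ⟨partialConv a (dirichletKernel (n a)) h, integrable_partialConv a hD hint,
      fun k => ?_, ?_⟩
    · rw [mFourierCoeff_partialConv a hD hint, hcoeff, fourierCoeff_dirichletKernel,
        Finset.prod_insert ha, mul_assoc]
    · rw [Finset.prod_insert ha, mul_assoc]
      exact (eLpNorm_partialConv_le a hD hint hq).trans (mul_le_mul_right hnorm _)

/-- If `n_i ≤ n_a` for all `i ∈ S`, then the Lebesgue constants in the coordinates `S` use up only half
of the gain `n_a^{-1/4}`. -/
lemma prod_eLpNorm_dirichletKernel_mul_le {C C' : ℝ≥0} (hC1 : 1 ≤ C)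
    (hC : ∀ n : ℕ, 1 ≤ n → eLpNorm (dirichletKernel n) 1 AddCircle.haarAddCircle ≤
      C * (n : ℝ≥0∞) ^ (1 / (8 * (d : ℝ))))
    (n : Fin d → ℕ) (hn : ∀ i, 1 ≤ n i) (S : Finset (Fin d)) (a : Fin d)
    (hmax : ∀ i ∈ S, n i ≤ n a) :
    (∏ i ∈ S, eLpNorm (dirichletKernel (n i)) 1 AddCircle.haarAddCircle) *
      (C' * (n a : ℝ≥0∞) ^ (-(1 / 4) : ℝ)) ≤
        (C : ℝ≥0∞) ^ d * C' * (n a : ℝ≥0∞) ^ (-(1 / 8) : ℝ) := by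
  have hd : (d : ℝ) ≠ 0 := by
    have := a.pos
    positivity
  have h1 : ∏ i ∈ S, eLpNorm (dirichletKernel (n i)) 1 AddCircle.haarAddCircle ≤
      ∏ _i ∈ S, (C * (n a : ℝ≥0∞) ^ (1 / (8 * (d : ℝ)))) := by
    refine Finset.prod_le_prod' fun i hi => (hC (n i) (hn i)).trans ?_
    have : (n i : ℝ≥0∞) ≤ n a := by exact_mod_cast hmax i hi
    gcongr
  have hna : (1 : ℝ≥0∞) ≤ n a := by exact_mod_cast hn a
  have h2 : (1 : ℝ≥0∞) ≤ C * (n a : ℝ≥0∞) ^ (1 / (8 * (d : ℝ))) :=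
    one_le_mul (by exact_mod_cast hC1) (ENNReal.one_le_rpow hna (by positivity))
  have h3 : ∏ i ∈ S, eLpNorm (dirichletKernel (n i)) 1 AddCircle.haarAddCircle ≤
      (C : ℝ≥0∞) ^ d * (n a : ℝ≥0∞) ^ (1 / 8 : ℝ) := by
    refine h1.trans ?_
    rw [Finset.prod_const]
    refine (pow_le_pow_right₀ h2 ((Finset.card_le_univ S).trans_eq (Fintype.card_fin d))).trans_eq ?_
    rw [mul_pow, ← ENNReal.rpow_natCast ((n a : ℝ≥0∞) ^ _), ← ENNReal.rpow_mul]
    congr 2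
    field_simp
  have h4 : (n a : ℝ≥0∞) ^ (-(1 / 8) : ℝ) =
      (n a : ℝ≥0∞) ^ (1 / 8 : ℝ) * (n a : ℝ≥0∞) ^ (-(1 / 4) : ℝ) := by
    rw [← ENNReal.rpow_add _ _ (zero_lt_one.trans_le hna).ne' (ENNReal.natCast_ne_top _)]
    norm_num
  refine (mul_le_mul_left h3 _).trans_eq ?_
  rw [h4]
  ring

lemma sawtoothTailCoeff_mul (n : ℕ) (l : ℤ) (z : ℂ) :
    sawtoothTailCoeff n l * (2 * Real.pi * Complex.I * l * z) =
      (1 - if |l| ≤ n then 1 else 0) * z := by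
  unfold sawtoothTailCoeff
  split_ifs with h
  · simp
  · have hl : (l : ℂ) ≠ 0 := by
      rintro h0
      rw [Int.cast_eq_zero] at h0
      subst h0
      simp at h
    have hpi : (Real.pi : ℂ) ≠ 0 := by exact_mod_cast Real.pi_ne_zero
    have : (2 * Real.pi * Complex.I * l : ℂ) ≠ 0 := by
      simp [hl, hpi, Complex.I_ne_zero]
    rw [sub_zero, one_mul, inv_mul_cancel_left₀ this]

lemma minIndex_le (n : Fin d → ℕ) (i : Fin d) : minIndex n ≤ n i :=
  ciInf_le (OrderBot.bddBelow _) i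

/-- The remainder `f - T_n f` telescopes into terms in which one coordinate `a` carries the gain
`n_a^{-1/4}` from the derivative, and partial sums act on coordinates `i` with `n_i ≤ n_a` only.
Because of this ordering, the Lebesgue constants that they cost are powers of `n_a`, however much
the `n_i` differ. -/
lemma exists_rectangular_remainder {q : ℝ} (hq : 1 < q) {C C' : ℝ≥0} (hC1 : 1 ≤ C)
    (hC : ∀ n : ℕ, 1 ≤ n → eLpNorm (dirichletKernel n) 1 AddCircle.haarAddCircle ≤
      C * (n : ℝ≥0∞) ^ (1 / (8 * (d : ℝ))))
    (hC' : ∀ n : ℕ, 1 ≤ n → ∃ K : UnitAddCircle → ℂ, Integrable K AddCircle.haarAddCircle ∧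
      (∀ l, fourierCoeff K l = sawtoothTailCoeff n l) ∧
      eLpNorm K 1 AddCircle.haarAddCircle ≤ C' * (n : ℝ≥0∞) ^ (-(1 / 4) : ℝ))
    {f : Torus d → ℂ} {G : Torus d → EuclideanSpace ℂ (Fin d)} (hG : IsWeakGradient f G)
    (n : Fin d → ℕ) (hn : 1 ≤ minIndex n) (S : Finset (Fin d)) :
    ∃ h : Torus d → ℂ, Integrable h (torusMeasure d) ∧
      (∀ k, UnitAddTorus.mFourierCoeff h k =
        (1 - ∏ i ∈ S, if |k i| ≤ (n i : ℤ) then 1 else 0) * UnitAddTorus.mFourierCoeff f k) ∧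
      eLpNorm h (ENNReal.ofReal q) (torusMeasure d) ≤
        S.card * ((C : ℝ≥0∞) ^ d * C' * (minIndex n : ℝ≥0∞) ^ (-(1 / 8) : ℝ) *
          eLpNorm G (ENNReal.ofReal q) (torusMeasure d)) := by
  classical
  have hn' : ∀ i, 1 ≤ n i := fun i => hn.trans (minIndex_le n i)
  induction S using Finset.induction_on_max_value n with
  | empty =>
    exact ⟨0, integrable_zero _ _ _, by simp [mFourierCoeff_eq_integral_torusMeasure], by simp⟩
  | insert a S ha hmax ih =>
    obtain ⟨h, hint, hcoeff, hnorm⟩ := ih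
    obtain ⟨K, hK, hKcoeff, hKnorm⟩ := hC' (n a) (hn' a)
    have hGa := hG.integrable_apply a
    obtain ⟨h', hint', hcoeff', hnorm'⟩ :=
      exists_rectangular_truncation (integrable_partialConv a hK hGa) hq n S
    refine ⟨h + h', hint.add hint', fun k => ?_, ?_⟩
    · rw [mFourierCoeff_add hint hint', hcoeff, hcoeff', mFourierCoeff_partialConv a hK hGa,
        hKcoeff, hG.mFourierCoeff_apply, sawtoothTailCoeff_mul, Finset.prod_insert ha]
      ring
    · have h1 : eLpNorm h' (ENNReal.ofReal q) (torusMeasure d) ≤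
          (C : ℝ≥0∞) ^ d * C' * (minIndex n : ℝ≥0∞) ^ (-(1 / 8) : ℝ) *
            eLpNorm G (ENNReal.ofReal q) (torusMeasure d) := by
        have h2 := (eLpNorm_partialConv_le a hK hGa hq).trans
          (mul_le_mul' hKnorm (eLpNorm_apply_le G a _))
        refine (hnorm'.trans (mul_le_mul_right h2 _)).trans ?_
        rw [← mul_assoc]
        refine mul_le_mul_left ?_ _
        refine (prod_eLpNorm_dirichletKernel_mul_le hC1 hC n hn' S a hmax).trans ?_
        refine mul_le_mul_right ?_ _
        rw [ENNReal.rpow_neg, ENNReal.rpow_neg]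
        have : (minIndex n : ℝ≥0∞) ≤ n a := by exact_mod_cast minIndex_le n a
        gcongr
      refine (eLpNorm_add_le hint.aestronglyMeasurable hint'.aestronglyMeasurable
        (by simpa using hq.le)).trans ((add_le_add hnorm h1).trans_eq ?_)
      rw [Finset.card_insert_of_notMem ha]
      push_cast
      ring

lemma eLpNorm_partialSum_sub_le {q : ℝ} (hq : 1 < q) {C C' : ℝ≥0} (hC1 : 1 ≤ C)
    (hC : ∀ n : ℕ, 1 ≤ n → eLpNorm (dirichletKernel n) 1 AddCircle.haarAddCircle ≤
      C * (n : ℝ≥0∞) ^ (1 / (8 * (d : ℝ))))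
    (hC' : ∀ n : ℕ, 1 ≤ n → ∃ K : UnitAddCircle → ℂ, Integrable K AddCircle.haarAddCircle ∧
      (∀ l, fourierCoeff K l = sawtoothTailCoeff n l) ∧
      eLpNorm K 1 AddCircle.haarAddCircle ≤ C' * (n : ℝ≥0∞) ^ (-(1 / 4) : ℝ))
    {f : Torus d → ℂ} {G : Torus d → EuclideanSpace ℂ (Fin d)} (hG : IsWeakGradient f G)
    (n m : Fin d → ℕ) (hn : 1 ≤ minIndex n) (hm : 1 ≤ minIndex m) :
    eLpNorm (partialSum n f - partialSum m f) (ENNReal.ofReal q) (torusMeasure d) ≤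
      ((2 * d * C ^ d * C' : ℝ≥0) : ℝ≥0∞) /
        min ((minIndex m : ℝ≥0∞) ^ (1 / 8 : ℝ)) ((minIndex n : ℝ≥0∞) ^ (1 / 8 : ℝ)) *
          eLpNorm G (ENNReal.ofReal q) (torusMeasure d) := by
  obtain ⟨h₁, hint₁, hcoeff₁, hnorm₁⟩ :=
    exists_rectangular_remainder hq hC1 hC hC' hG m hm Finset.univ
  obtain ⟨h₂, hint₂, hcoeff₂, hnorm₂⟩ :=
    exists_rectangular_remainder hq hC1 hC hC' hG n hn Finset.univ
  have hae : partialSum n f - partialSum m f =ᵐ[torusMeasure d] h₁ - h₂ := by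
    refine ae_eq_of_mFourierCoeff_eq ((integrable_partialSum n f).sub (integrable_partialSum m f))
      (hint₁.sub hint₂) fun k => ?_
    rw [mFourierCoeff_sub (integrable_partialSum n f) (integrable_partialSum m f),
      mFourierCoeff_sub hint₁ hint₂, hcoeff₁, hcoeff₂, mFourierCoeff_partialSum,
      mFourierCoeff_partialSum]
    ring
  rw [eLpNorm_congr_ae hae]
  set M := min ((minIndex m : ℝ≥0∞) ^ (1 / 8 : ℝ)) ((minIndex n : ℝ≥0∞) ^ (1 / 8 : ℝ))
  have hM₁ : (minIndex m : ℝ≥0∞) ^ (-(1 / 8) : ℝ) ≤ M⁻¹ := by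
    rw [ENNReal.rpow_neg]
    exact ENNReal.inv_le_inv.2 (min_le_left _ _)
  have hM₂ : (minIndex n : ℝ≥0∞) ^ (-(1 / 8) : ℝ) ≤ M⁻¹ := by
    rw [ENNReal.rpow_neg]
    exact ENNReal.inv_le_inv.2 (min_le_right _ _)
  rw [Finset.card_univ, Fintype.card_fin] at hnorm₁ hnorm₂
  calc eLpNorm (h₁ - h₂) (ENNReal.ofReal q) (torusMeasure d)
      ≤ eLpNorm h₁ (ENNReal.ofReal q) (torusMeasure d) +
          eLpNorm h₂ (ENNReal.ofReal q) (torusMeasure d) :=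
        eLpNorm_sub_le hint₁.aestronglyMeasurable hint₂.aestronglyMeasurable (by simpa using hq.le)
    _ ≤ d * ((C : ℝ≥0∞) ^ d * C' * M⁻¹ * eLpNorm G (ENNReal.ofReal q) (torusMeasure d)) +
          d * ((C : ℝ≥0∞) ^ d * C' * M⁻¹ * eLpNorm G (ENNReal.ofReal q) (torusMeasure d)) :=
        add_le_add (hnorm₁.trans (by gcongr)) (hnorm₂.trans (by gcongr))
    _ = _ := by
        rw [div_eq_mul_inv]
        push_cast
        ring

/-- A function with mean zero and vanishing gradient norm has no Fourier coefficients. The infimum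
in `gradNorm` need not be known to be attained: each weak gradient bounds the coefficients. -/
lemma mFourierCoeff_eq_zero_of_gradNorm_eq_zero {q : ℝ} (hq : 1 < q) {f : Torus d → ℂ}
    (hf : ∫ x, f x ∂torusMeasure d = 0) (hgrad : gradNorm (ENNReal.ofReal q) f = 0)
    (k : Fin d → ℤ) : UnitAddTorus.mFourierCoeff f k = 0 := by
  by_cases hk : k = 0
  · subst hk
    rw [mFourierCoeff_eq_integral_torusMeasure, neg_zero, UnitAddTorus.mFourier_zero]
    simpa using hf
  obtain ⟨j, hj⟩ := Function.ne_iff.1 hk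
  have h1 : ‖2 * Real.pi * Complex.I * k j * UnitAddTorus.mFourierCoeff f k‖ₑ ≤
      gradNorm (ENNReal.ofReal q) f := by
    refine le_iInf₂ fun G hG => ?_
    rw [← hG.mFourierCoeff_apply]
    refine (enorm_mFourierCoeff_le_eLpNorm_one _ k).trans ((eLpNorm_apply_le G j 1).trans ?_)
    exact eLpNorm_le_eLpNorm_of_exponent_le (by simpa using hq.le) hG.2.1.aestronglyMeasurable
  rw [hgrad, nonpos_iff_eq_zero, enorm_eq_zero] at h1
  have hj' : k j ≠ 0 := hj
  simpa [Real.pi_ne_zero, Complex.I_ne_zero, hj'] using h1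

end TorusSobolev

end

open TorusSobolev in
theorem lemma2p1 (q : ℝ) (hq : 1 < q) :
    ∃ α : ℝ, 0 < α ∧ α ≤ 1 ∧ ∀ d : ℕ, 1 ≤ d → ∃ C : ℝ≥0, 0 < C ∧
      ∀ f : Torus d → ℂ, MemSobolev 1 (ENNReal.ofReal q) f → ∫ x, f x ∂torusMeasure d = 0 →
        ∀ n m : Fin d → ℕ,
          eLpNorm (partialSum n f - partialSum m f) (ENNReal.ofReal q) (torusMeasure d) ≤
            (C : ℝ≥0∞) / min ((minIndex m : ℝ≥0∞) ^ α) ((minIndex n : ℝ≥0∞) ^ α) *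
              gradNorm (ENNReal.ofReal q) f := by
  refine ⟨1 / 8, by norm_num, by norm_num, fun d hd => ?_⟩
  have hd' : (1 : ℝ) ≤ d := by exact_mod_cast hd
  obtain ⟨C₀, hC₀⟩ := exists_eLpNorm_dirichletKernel_le (ε := 1 / (8 * (d : ℝ))) (by positivity)
    (by rw [div_le_one (by positivity)]; linarith)
  obtain ⟨C', hC'⟩ := exists_sawtoothTail
  set C := max C₀ 1 with hCdef
  have hC : ∀ n : ℕ, 1 ≤ n → eLpNorm (dirichletKernel n) 1 AddCircle.haarAddCircle ≤
      C * (n : ℝ≥0∞) ^ (1 / (8 * (d : ℝ))) := fun n hn =>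
    (hC₀ n hn).trans (mul_le_mul_left (by exact_mod_cast le_max_left C₀ 1) _)
  refine ⟨2 * d * C ^ d * C' + 1, by positivity, fun f _ hf0 n m => ?_⟩
  set M := min ((minIndex m : ℝ≥0∞) ^ (1 / 8 : ℝ)) ((minIndex n : ℝ≥0∞) ^ (1 / 8 : ℝ)) with hM
  by_cases hmin : 1 ≤ minIndex n ∧ 1 ≤ minIndex m
  · obtain ⟨hn, hm⟩ := hmin
    have hMtop : M ≠ ⊤ := ne_top_of_le_ne_top
      (ENNReal.rpow_ne_top_of_nonneg (by norm_num) (ENNReal.natCast_ne_top _)) (min_le_left _ _)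
    have hM0 : M ≠ 0 := by
      refine (lt_min ?_ ?_).ne'
      · exact ENNReal.rpow_pos (by exact_mod_cast hm) (ENNReal.natCast_ne_top _)
      · exact ENNReal.rpow_pos (by exact_mod_cast hn) (ENNReal.natCast_ne_top _)
    have hne0 : ((2 * d * C ^ d * C' + 1 : ℝ≥0) : ℝ≥0∞) / M ≠ 0 :=
      ENNReal.div_ne_zero.2 ⟨by simp, hMtop⟩
    have hnetop : ((2 * d * C ^ d * C' + 1 : ℝ≥0) : ℝ≥0∞) / M ≠ ⊤ :=
      ENNReal.div_ne_top ENNReal.coe_ne_top hM0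
    rw [mul_comm, ← ENNReal.div_le_iff hne0 hnetop]
    refine le_iInf₂ fun G hG => ?_
    rw [ENNReal.div_le_iff hne0 hnetop, mul_comm]
    refine (eLpNorm_partialSum_sub_le hq (le_max_right _ _) hC hC' hG n m hn hm).trans ?_
    refine mul_le_mul_left (ENNReal.div_le_div_right ?_ _) _
    exact_mod_cast le_self_add
  · have hM0 : M = 0 := by
      rw [hM]
      rcases not_and_or.1 hmin with h | h
      · rw [Nat.lt_one_iff.1 (not_le.1 h)]
        simp
      · rw [Nat.lt_one_iff.1 (not_le.1 h)]
        simp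
    by_cases hgrad : gradNorm (ENNReal.ofReal q) f = 0
    · -- here the right side is `∞ * 0 = 0`, so the partial sums themselves have to vanish
      have hzero : ∀ l : Fin d → ℕ, partialSum l f = 0 := fun l => by
        ext x
        simp [partialSum, mFourierCoeff_eq_zero_of_gradNorm_eq_zero hq hf0 hgrad]
      simp [hzero]
    · rw [hM0, ENNReal.div_zero (by simp), ENNReal.top_mul hgrad]
      exact le_top
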